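/- **Theorem (global in-expectation minimax lower bounds, Gaussian scores).** Let $K,J\ge 1$ be integers, let $\sigma_{k,j}>0$ ($k\in[K]$, $j\in[J]$), costs $c_j>0$ and a budget $B>0$ be given. For an unknown score vector $s\in\mathbb{R}^K$, each query of a pair $(k,j)$ costs $c_j$ and returns an independent observation from $\mathcal{N}(s_k,\sigma_{k,j}^2)$. A budget-constrained adaptive estimator $\hat s$ chooses (possibly at random) in each round which pair to query, or to stop, on the basis of the observations so far, and finally outputs $\hat s\in\mathbb{R}^K$ as a (possibly randomized) function of the whole history; its numbers of queries $N_{k,j}$ must satisfy $\sum_{j}c_j\sum_{k}N_{k,j}\le B$ almost surely, for every $s$. It may depend on $\sigma$, $c$, $B$. For $1\le p\le\infty$ put $$\mathcal{A}_p^*(\sigma,c)=\min_{\omega}\Bigl(\sum_{k=1}^K\Bigl(\sum_{j=1}^J\frac{\omega_{k,j}}{c_j\sigma_{k,j}^2}\Bigr)^{-p/2}\Bigr)^{2/p},$$ the minimum being over all $\omega\in[0,\infty)^{K\times J}$ with $\sum_{k,j}\omega_{k,j}=1$ (for $p=\infty$ the objective is $\max_k(\sum_j\omega_{k,j}/(c_j\sigma_{k,j}^2))^{-1}$;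 the objective is $+\infty$ if $\omega_{k,j}=0$ for all $j$, for some $k$). Then for each $1\le p\le\infty$, $$\inf_{\hat s}\ \sup_{s\in\mathbb{R}^K}\ \mathbb{E}_s\bigl[\|\hat s-s\|_p\bigr]\ \ge\ \sqrt{\frac{2}{\pi}}\,\sqrt{\frac{\mathcal{A}_p^*(\sigma,c)}{B}},$$ and for each $1\le p<\infty$, $$\inf_{\hat s}\ \sup_{s\in\mathbb{R}^K}\ \mathbb{E}_s\bigl[\|\hat s-s\|_p^p\bigr]^{1/p}\ \ge\ m_p\,\sqrt{\frac{\mathcal{A}_p^*(\sigma,c)}{B}},\qquad m_p=\mathbb{E}[|Z|^p]^{1/p}=\sqrt2\Bigl(\frac{\Gamma((p+1)/2)}{\sqrt\pi}\Bigr)^{1/p},\quad Z\sim\mathcal{N}(0,1),$$ where the infima are over all budget-constrained adaptive estimators. -/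

import Mathlib

open MeasureTheory ProbabilityTheory
open scoped ENNReal NNReal

noncomputable section

namespace JudgeEstimation

/-- What a learner can do in one round: send query `k` to judge `j`, or do nothing. A learner which
terminates early (possibly at a random, data-dependent time) does nothing in all later rounds. -/
inductive Action (K J : ℕ) : Type
  | query (k : Fin K) (j : Fin J) : Action K J
  | idle : Action K J
  deriving DecidableEq

instance (K J : ℕ) : MeasurableSpace (Action K J) := ⊤

/-- The history of the first `t` rounds: the actions taken and the scores observed. -/
abbrev History (K J t : ℕ) : Type := Fin t → Action K J × ℝ

/-- An adaptive, possibly randomized algorithm: in each of `horizon` rounds the action is drawn from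
a probability distribution depending measurably on the history so far, and at the end the estimate
is drawn from a probability distribution on `ℝ^K` depending measurably on the whole history.
Deterministic rules are Dirac kernels. -/
structure Algorithm (K J : ℕ) where
  horizon : ℕ
  policy : (t : ℕ) → Kernel (History K J t) (Action K J)
  policy_markov : ∀ t, IsMarkovKernel (policy t)
  estimator : Kernel (History K J horizon) (Fin K → ℝ)
  estimator_markov : IsMarkovKernel estimator

attribute [instance] Algorithm.policy_markov Algorithm.estimator_markov

variable {K J : ℕ}

/-- The distribution of the score observed after an action, for true scores `s` and standard
deviations `σ`: querying `(k, j)` yields `N(s k, (σ k j) ^ 2)`; no score is observed in an idle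
round, which is recorded as the constant `0`. -/
def scoreMeasure (s : Fin K → ℝ) (σ : Fin K → Fin J → ℝ) : Action K J → Measure ℝ
  | .query k j => gaussianReal (s k) (Real.toNNReal (σ k j ^ 2))
  | .idle => Measure.dirac 0

/-- `scoreMeasure` as a Markov kernel from actions to scores. -/
def scoreKernel (s : Fin K → ℝ) (σ : Fin K → Fin J → ℝ) : Kernel (Action K J) ℝ where
  toFun := scoreMeasure s σ
  measurable' := measurable_from_top

instance (s : Fin K → ℝ) (σ : Fin K → Fin J → ℝ) : IsMarkovKernel (scoreKernel s σ) where
  isProbabilityMeasure a := by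
    change IsProbabilityMeasure (scoreMeasure s σ a)
    cases a with
    | query k j => exact inferInstanceAs (IsProbabilityMeasure (gaussianReal (s k) _))
    | idle => exact inferInstanceAs (IsProbabilityMeasure (Measure.dirac 0))

/-- Append one round to a history. -/
def History.snoc {t : ℕ} (x : History K J t × (Action K J × ℝ)) : History K J (t + 1) :=
  Fin.snoc (α := fun _ => Action K J × ℝ) x.1 x.2

theorem History.measurable_snoc {t : ℕ} :
    Measurable (History.snoc : History K J t × (Action K J × ℝ) → History K J (t + 1)) := by
  refine measurable_pi_lambda _ fun i => ?_
  refine Fin.lastCases ?_ (fun i => ?_) i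
  · simpa [History.snoc] using measurable_snd
  · simpa [History.snoc, Function.comp_def] using (measurable_pi_apply i).comp
      (measurable_fst (α := History K J t) (β := Action K J × ℝ))

namespace Algorithm

/-- The joint conditional distribution of the action and the score of round `t`, given the history:
the action follows the policy and the score depends on the past only through that action. -/
def stepKernel (A : Algorithm K J) (s : Fin K → ℝ) (σ : Fin K → Fin J → ℝ) (t : ℕ) :
    Kernel (History K J t) (Action K J × ℝ) :=
  A.policy t ⊗ₖ Kernel.prodMkLeft (History K J t) (scoreKernel s σ)

instance (A : Algorithm K J) (s : Fin K → ℝ) (σ : Fin K → Fin J → ℝ) (t : ℕ) :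
    IsMarkovKernel (A.stepKernel s σ t) := by
  unfold stepKernel; infer_instance

/-- The distribution of the history of the first `t` rounds, for true scores `s` and standard
deviations `σ`. -/
def historyLaw (A : Algorithm K J) (s : Fin K → ℝ) (σ : Fin K → Fin J → ℝ) :
    (t : ℕ) → Measure (History K J t)
  | 0 => Measure.dirac Fin.elim0
  | t + 1 => ((A.historyLaw s σ t) ⊗ₘ (A.stepKernel s σ t)).map History.snoc

instance isProbabilityMeasure_historyLaw (A : Algorithm K J) (s : Fin K → ℝ)
    (σ : Fin K → Fin J → ℝ) (t : ℕ) : IsProbabilityMeasure (A.historyLaw s σ t) := by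
  induction t with
  | zero => unfold historyLaw; infer_instance
  | succ t ih =>
    unfold historyLaw
    exact Measure.isProbabilityMeasure_map History.measurable_snoc.aemeasurable

/-- The distribution of the estimate output by the algorithm. -/
def estimateLaw (A : Algorithm K J) (s : Fin K → ℝ) (σ : Fin K → Fin J → ℝ) :
    Measure (Fin K → ℝ) :=
  (A.historyLaw s σ A.horizon).bind A.estimator

instance (A : Algorithm K J) (s : Fin K → ℝ) (σ : Fin K → Fin J → ℝ) :
    IsProbabilityMeasure (A.estimateLaw s σ) := by
  unfold estimateLaw; infer_instance

end Algorithm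

/-- The number of times the pair `(k, j)` is queried in a history. -/
def numQueries {t : ℕ} (h : History K J t) (k : Fin K) (j : Fin J) : ℕ :=
  (Finset.univ.filter fun i : Fin t => (h i).1 = Action.query k j).card

/-- The algorithm almost surely spends at most the budget `B`, whatever the true scores are. -/
def Algorithm.WithinBudget (A : Algorithm K J) (σ : Fin K → Fin J → ℝ) (c : Fin J → ℝ)
    (B : ℝ) : Prop :=
  ∀ s : Fin K → ℝ, ∀ᵐ h ∂(A.historyLaw s σ A.horizon),
    ∑ j, c j * ∑ k, (numQueries h k j : ℝ) ≤ B

/-- The `ℓ_p` norm on `ℝ^K`, as an extended nonnegative real. -/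
def ellNorm (p : ℝ≥0∞) (x : Fin K → ℝ) : ℝ≥0∞ := ENNReal.ofReal ‖WithLp.toLp p x‖

/-- The risk `E_s[‖ŝ - s‖_p]`. -/
def Algorithm.risk (A : Algorithm K J) (σ : Fin K → Fin J → ℝ) (p : ℝ≥0∞) (s : Fin K → ℝ) :
    ℝ≥0∞ :=
  ∫⁻ x, ellNorm p (x - s) ∂(A.estimateLaw s σ)

/-- The risk `E_s[‖ŝ - s‖_p ^ p] ^ (1 / p)`, for finite `p`. -/
def Algorithm.momentRisk (A : Algorithm K J) (σ : Fin K → Fin J → ℝ) (p : ℝ≥0∞)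
    (s : Fin K → ℝ) : ℝ≥0∞ :=
  (∫⁻ x, ellNorm p (x - s) ^ p.toReal ∂(A.estimateLaw s σ)) ^ (1 / p.toReal)

/-- The allocation objective
`𝒜_p(ω; σ, c) = (∑_k (∑_j ω_{k,j} / (c_j σ_{k,j}²)) ^ (- p / 2)) ^ (2 / p)`, with the usual limit
`max_k (∑_j ω_{k,j} / (c_j σ_{k,j}²))⁻¹` for `p = ∞`; it is `∞` if some query gets no budget. -/
def allocObjective (p : ℝ≥0∞) (ω : Fin K → Fin J → ℝ) (σ : Fin K → Fin J → ℝ)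
    (c : Fin J → ℝ) : ℝ≥0∞ :=
  if p = ∞ then ⨆ k, (ENNReal.ofReal (∑ j, ω k j / (c j * σ k j ^ 2)))⁻¹
  else (∑ k, ENNReal.ofReal (∑ j, ω k j / (c j * σ k j ^ 2)) ^ (-(p.toReal / 2))) ^ (2 / p.toReal)

/-- The set `Λ^{KJ}` of allocations: the probability simplex indexed by the pairs `(k, j)`. -/
def allocations (K J : ℕ) : Set (Fin K → Fin J → ℝ) :=
  {ω | (∀ k j, 0 ≤ ω k j) ∧ ∑ k, ∑ j, ω k j = 1}

/-- The optimal value `𝒜_p^*(σ, c)` of the allocation problem. -/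
def optAlloc (p : ℝ≥0∞) (σ : Fin K → Fin J → ℝ) (c : Fin J → ℝ) : ℝ≥0∞ :=
  ⨅ ω ∈ allocations K J, allocObjective p ω σ c

/-- `m_p = E[|Z| ^ p] ^ (1 / p)` for a standard Gaussian variable `Z`. -/
def gaussianMoment (p : ℝ) : ℝ := (∫ z, |z| ^ p ∂(gaussianReal 0 1)) ^ (1 / p)

end JudgeEstimation

end

/-! Bayes risk argument with a vanishing prior precision. Give the scores independent centred
Gaussian priors of precision `ε`. The policy does not depend on the scores, so it cancels from the
likelihood ratio (`lintegral_historyLaw`). Hence, however adaptive the queries, the posterior is a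
product of Gaussians with precisions `ε + totalPrecision` (`lintegral_likelihood_mul_prior`), and
the worst-case risk is at least any almost sure lower bound on the posterior expected loss
(`le_of_forall_risk_le`).

No point estimates a Gaussian better than its mean does (`le_lintegral_abs_sub_rpow_gaussianReal`),
so the posterior loss is at least a Gaussian moment times the norm of the posterior deviations. For
`‖·‖_p` this needs Jensen's inequality; for `‖·‖_p ^ p` the coordinates decouple.

The deviations are those of an allocation: normalizing the money spent on each pair gives a point of
the simplex, which bounds their norm by `optAlloc` (`optAlloc_div_rpow_le_ellNorm`). The prior
counts as a few extra fractional queries, whose cost vanishes as `ε → 0`. -/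

namespace MeasureTheory

/-! ### Densities on finite product spaces. -/

variable {ι : Type*} [Fintype ι] {X : ι → Type*} [∀ i, MeasurableSpace (X i)]

theorem lintegral_pi_prod (μ : ∀ i, Measure (X i)) [∀ i, IsProbabilityMeasure (μ i)]
    {f : ∀ i, X i → ℝ≥0∞} (hf : ∀ i, Measurable (f i)) :
    ∫⁻ x, ∏ i, f i (x i) ∂(Measure.pi μ) = ∏ i, ∫⁻ x, f i x ∂(μ i) := by
  have hind := iIndepFun_pi (μ := μ) (X := f) fun i => (hf i).aemeasurable
  have := lintegral_prod_eq_prod_lintegral_of_indepFun Finset.univ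
    (fun i (x : ∀ i, X i) => f i (x i)) hind fun i => (hf i).comp (measurable_pi_apply i)
  rw [this]
  refine Finset.prod_congr rfl fun i _ => ?_
  exact (measurePreserving_eval μ i).lintegral_comp (hf i)

theorem Measure.pi_withDensity (μ : ∀ i, Measure (X i)) [∀ i, IsProbabilityMeasure (μ i)]
    {f : ∀ i, X i → ℝ≥0∞} (hf : ∀ i, Measurable (f i))
    [∀ i, SigmaFinite ((μ i).withDensity (f i))] :
    (Measure.pi μ).withDensity (fun x => ∏ i, f i (x i)) =
      Measure.pi fun i => (μ i).withDensity (f i) := by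
  classical
  refine (Measure.pi_eq fun s hs => ?_).symm
  rw [withDensity_apply _ (MeasurableSet.univ_pi hs),
    ← lintegral_indicator (MeasurableSet.univ_pi hs)]
  have : ∀ x : ∀ i, X i, (Set.univ.pi s).indicator (fun x => ∏ i, f i (x i)) x =
      ∏ i, (s i).indicator (f i) (x i) := by
    intro x
    by_cases hx : x ∈ Set.univ.pi s
    · rw [Set.indicator_of_mem hx]
      exact Finset.prod_congr rfl fun i _ => (Set.indicator_of_mem (hx i trivial) _).symm
    · rw [Set.indicator_of_notMem hx]
      obtain ⟨i, hi⟩ : ∃ i, x i ∉ s i := by simpa [Set.mem_univ_pi] using hx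
      exact (Finset.prod_eq_zero (Finset.mem_univ i) (Set.indicator_of_notMem hi _)).symm
  simp_rw [this]
  rw [lintegral_pi_prod μ fun i => (hf i).indicator (hs i)]
  refine Finset.prod_congr rfl fun i _ => ?_
  rw [lintegral_indicator (hs i), withDensity_apply _ (hs i)]

/-- Lifts Gaussian conjugacy from single coordinates to the product prior; the constants `C i`
become the marginal likelihood. -/
theorem lintegral_pi_prod_mul {μ ν : ∀ i, Measure (X i)} [∀ i, IsProbabilityMeasure (μ i)]
    [∀ i, IsProbabilityMeasure (ν i)] {f : ∀ i, X i → ℝ≥0∞} (hf : ∀ i, Measurable (f i))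
    {C : ι → ℝ≥0∞} (hC : ∀ i, C i ≠ ∞)
    (h : ∀ i, (μ i).withDensity (f i) = C i • ν i) {G : (∀ i, X i) → ℝ≥0∞} (hG : Measurable G) :
    ∫⁻ x, (∏ i, f i (x i)) * G x ∂(Measure.pi μ) = (∏ i, C i) * ∫⁻ x, G x ∂(Measure.pi ν) := by
  have hfin : ∀ i, IsFiniteMeasure ((μ i).withDensity (f i)) := fun i => by
    rw [h i]; exact Measure.smul_finite _ (hC i)
  have hmeas : Measurable fun x : ∀ i, X i => ∏ i, f i (x i) :=
    Finset.measurable_prod _ fun i _ => (hf i).comp (measurable_pi_apply i)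
  have hpi : (Measure.pi fun i => (μ i).withDensity (f i)) = (∏ i, C i) • Measure.pi ν := by
    refine Measure.pi_eq fun s hs => ?_
    simp [h, Measure.pi_pi, Finset.prod_mul_distrib]
  rw [← smul_eq_mul, ← lintegral_smul_measure, ← hpi, ← Measure.pi_withDensity μ hf,
    lintegral_withDensity_eq_lintegral_mul _ hmeas hG]
  rfl

end MeasureTheory

/-! ### Gaussian densities and absolute moments. -/

namespace ProbabilityTheory

/-- Gaussian conjugacy: tilting a centred Gaussian of precision `ε` by the likelihood of a total
precision `L` and a weighted score `S`. -/
theorem gaussianReal_withDensity_exp {ε L : ℝ} (hε : 0 < ε) (hL : 0 ≤ L) (S : ℝ) :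
    (gaussianReal 0 (Real.toNNReal ε⁻¹)).withDensity
        (fun x => ENNReal.ofReal (Real.exp (x * S - x ^ 2 / 2 * L))) =
      ENNReal.ofReal (Real.sqrt (ε / (ε + L)) * Real.exp (S ^ 2 / (2 * (ε + L)))) •
        gaussianReal (S / (ε + L)) (Real.toNNReal (ε + L)⁻¹) := by
  have hεL : 0 < ε + L := by positivity
  have h1 : Real.toNNReal ε⁻¹ ≠ 0 := by simpa using hε
  have h2 : Real.toNNReal (ε + L)⁻¹ ≠ 0 := by simpa using hεL
  rw [gaussianReal_of_var_ne_zero _ h1, gaussianReal_of_var_ne_zero _ h2,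
    ← withDensity_smul _ (measurable_gaussianPDF _ _),
    ← withDensity_mul _ (measurable_gaussianPDF _ _) (by fun_prop)]
  congr 1
  ext x
  simp only [Pi.mul_apply, Pi.smul_apply, smul_eq_mul, gaussianPDF]
  rw [← ENNReal.ofReal_mul (gaussianPDFReal_nonneg _ _ _), ← ENNReal.ofReal_mul (by positivity)]
  congr 1
  simp only [gaussianPDFReal, Real.coe_toNNReal _ (inv_pos.2 hε).le,
    Real.coe_toNNReal _ (inv_pos.2 hεL).le]
  have hs : (Real.sqrt (2 * Real.pi * ε⁻¹))⁻¹ =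
      Real.sqrt (ε / (ε + L)) * (Real.sqrt (2 * Real.pi * (ε + L)⁻¹))⁻¹ := by
    rw [← Real.sqrt_inv, ← Real.sqrt_inv, ← Real.sqrt_mul (by positivity)]
    congr 1
    field_simp
  rw [hs, mul_assoc, ← Real.exp_add, mul_mul_mul_comm, ← Real.exp_add]
  congr 2
  field_simp
  ring

/-- The density of a Gaussian of mean `m` with respect to the centred one. -/
theorem gaussianReal_eq_withDensity {τ : ℝ} (hτ : 0 < τ) (m : ℝ) :
    gaussianReal m (Real.toNNReal (τ ^ 2)) =
      (gaussianReal 0 (Real.toNNReal (τ ^ 2))).withDensity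
        (fun y => ENNReal.ofReal (Real.exp (1 / τ ^ 2 * (m * y - m ^ 2 / 2)))) := by
  have h1 : Real.toNNReal (τ ^ 2) ≠ 0 := by simpa using hτ.ne'
  rw [gaussianReal_of_var_ne_zero _ h1, gaussianReal_of_var_ne_zero _ h1,
    ← withDensity_mul _ (measurable_gaussianPDF _ _) (by fun_prop)]
  congr 1
  ext x
  simp only [Pi.mul_apply, gaussianPDF]
  rw [← ENNReal.ofReal_mul (gaussianPDFReal_nonneg _ _ _)]
  congr 1
  simp only [gaussianPDFReal, Real.coe_toNNReal _ (sq_nonneg τ)]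
  rw [mul_assoc _ (Real.exp _), ← Real.exp_add]
  congr 2
  field_simp
  ring

theorem integrable_abs_rpow_gaussianReal (m : ℝ) (v : ℝ≥0) {q : ℝ} (hq : 0 < q) :
    Integrable (fun x => |x| ^ q) (gaussianReal m v) := by
  have := (memLp_id_gaussianReal' (μ := m) (v := v) (ENNReal.ofReal q) (by simp)).integrable_norm_rpow
    (by simpa using hq) (by simp)
  simpa [ENNReal.toReal_ofReal hq.le] using this

theorem integral_abs_rpow_gaussianReal {q : ℝ} (hq : 0 < q) :
    ∫ z, |z| ^ q ∂(gaussianReal 0 1) =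
      Real.sqrt 2 ^ q * (Real.Gamma ((q + 1) / 2) / Real.sqrt Real.pi) := by
  rw [integral_gaussianReal_eq_integral_smul one_ne_zero]
  have h : ∀ x : ℝ, gaussianPDFReal 0 1 x • |x| ^ q =
      (fun y => (Real.sqrt (2 * Real.pi))⁻¹ * (y ^ q * Real.exp (-(1 / 2) * y ^ (2 : ℝ)))) |x| := by
    intro x
    simp [gaussianPDFReal]
    ring_nf
  rw [integral_congr_ae (Filter.Eventually.of_forall h), integral_comp_abs
    (f := fun y => (Real.sqrt (2 * Real.pi))⁻¹ *
      (y ^ q * Real.exp (-(1 / 2) * y ^ (2 : ℝ)))), integral_const_mul,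
    integral_rpow_mul_exp_neg_mul_rpow two_pos (by linarith) (by norm_num)]
  rw [Real.sqrt_mul zero_le_two]
  have e : ((1 : ℝ) / 2) ^ (-(q + 1) / 2) = Real.sqrt 2 ^ q * Real.sqrt 2 := by
    rw [one_div, Real.inv_rpow zero_le_two, ← Real.rpow_neg zero_le_two, Real.sqrt_eq_rpow,
      ← Real.rpow_mul zero_le_two, ← Real.rpow_add two_pos]
    congr 1; ring
  rw [e]
  have : Real.sqrt 2 ≠ 0 := by positivity
  field_simp

/-- The absolute moments of a Gaussian about any point dominate those about its mean. -/
theorem le_lintegral_abs_sub_rpow_gaussianReal (m a : ℝ) {v : ℝ} (hv : 0 ≤ v) {q : ℝ}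
    (hq : 1 ≤ q) :
    ENNReal.ofReal ((∫ z, |z| ^ q ∂(gaussianReal 0 1)) * Real.sqrt v ^ q) ≤
      ∫⁻ x, ENNReal.ofReal (|a - x| ^ q) ∂(gaussianReal m (Real.toNNReal v)) := by
  have hq0 : 0 < q := by linarith
  have hmap : gaussianReal m (Real.toNNReal v) =
      (gaussianReal 0 1).map (fun z => Real.sqrt v * z + m) := by
    have := gaussianReal_map_const_mul (μ := 0) (v := 1) (Real.sqrt v)
    rw [show (fun z => Real.sqrt v * z + m) = (fun z => z + m) ∘ fun z => Real.sqrt v * z from rfl,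
      ← Measure.map_map (by fun_prop) (by fun_prop), this, gaussianReal_map_add_const]
    congr 1
    · simp
    · ext; simp [Real.sq_sqrt hv, hv]
  rw [hmap, lintegral_map (by fun_prop) (by fun_prop), mul_comm,
    ENNReal.ofReal_mul (by positivity), ofReal_integral_eq_lintegral_ofReal
      (integrable_abs_rpow_gaussianReal 0 1 hq0) (Filter.Eventually.of_forall fun x => by positivity),
    ← lintegral_const_mul _ (by fun_prop)]
  set I := ∫⁻ z, ENNReal.ofReal (|a - (Real.sqrt v * z + m)| ^ q) ∂(gaussianReal 0 1) with hI
  -- Symmetrization: averaging the loss at `z` and `-z` removes the offset `a - m`, by the triangle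
  -- inequality and convexity of `x ^ q`.
  have hI' : I = ∫⁻ z, ENNReal.ofReal (|a - (Real.sqrt v * -z + m)| ^ q) ∂(gaussianReal 0 1) := by
    have h := gaussianReal_map_neg (μ := 0) (v := 1)
    rw [neg_zero] at h
    conv_lhs => rw [hI, ← h]
    rw [lintegral_map (by fun_prop) (by fun_prop)]
  have key : ∀ z : ℝ, 2 * (ENNReal.ofReal (Real.sqrt v ^ q) * ENNReal.ofReal (|z| ^ q)) ≤
      ENNReal.ofReal (|a - (Real.sqrt v * z + m)| ^ q) +
        ENNReal.ofReal (|a - (Real.sqrt v * -z + m)| ^ q) := by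
    intro z
    rw [← ENNReal.ofReal_mul (by positivity), ← ENNReal.ofReal_add (by positivity) (by positivity),
      show (2 : ℝ≥0∞) = ENNReal.ofReal 2 by simp, ← ENNReal.ofReal_mul zero_le_two]
    refine ENNReal.ofReal_le_ofReal ?_
    set X := |a - (Real.sqrt v * z + m)|
    set Y := |a - (Real.sqrt v * -z + m)|
    have hXY : Real.sqrt v * |z| ≤ (1 / 2) * X + (1 / 2) * Y := by
      have : 2 * (Real.sqrt v * |z|) = |(a - (Real.sqrt v * -z + m)) - (a - (Real.sqrt v * z + m))| := by
        rw [show (a - (Real.sqrt v * -z + m)) - (a - (Real.sqrt v * z + m)) = 2 * (Real.sqrt v * z) by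
          ring, abs_mul, abs_mul, abs_of_nonneg (Real.sqrt_nonneg v), abs_two]
      have h2 := abs_sub (a - (Real.sqrt v * -z + m)) (a - (Real.sqrt v * z + m))
      simp only [X, Y]
      linarith
    have hc := (convexOn_rpow hq).2 (Set.mem_Ici.2 (abs_nonneg _) : X ∈ Set.Ici (0 : ℝ))
      (Set.mem_Ici.2 (abs_nonneg _) : Y ∈ Set.Ici (0 : ℝ))
      (one_half_pos (α := ℝ)).le (one_half_pos (α := ℝ)).le (add_halves 1)
    have hm := Real.rpow_le_rpow (by positivity) hXY hq0.le
    rw [Real.mul_rpow (Real.sqrt_nonneg v) (abs_nonneg z)] at hm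
    simp only [smul_eq_mul] at hc
    linarith
  have h2 : 2 * ∫⁻ z, ENNReal.ofReal (Real.sqrt v ^ q) * ENNReal.ofReal (|z| ^ q)
      ∂(gaussianReal 0 1) ≤ 2 * I := by
    rw [two_mul I]
    nth_rw 2 [hI']
    rw [hI, ← lintegral_add_left (by fun_prop), ← lintegral_const_mul _ (by fun_prop)]
    exact lintegral_mono key
  exact (ENNReal.mul_le_mul_iff_right two_ne_zero ENNReal.ofNat_ne_top).1 h2

end ProbabilityTheory

/-! ### Sufficient statistics and the likelihood of a history. -/

namespace JudgeEstimation

variable {K J : ℕ}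

/-- The precision about the score of query `k` gained by an action. -/
noncomputable def Action.precision (σ : Fin K → Fin J → ℝ) (k : Fin K) : Action K J → ℝ
  | .query k' j => if k' = k then 1 / σ k j ^ 2 else 0
  | .idle => 0

theorem Action.precision_nonneg (σ : Fin K → Fin J → ℝ) (k : Fin K) (a : Action K J) :
    0 ≤ a.precision σ k := by
  cases a with
  | query k' j => simp only [precision]; split_ifs <;> positivity
  | idle => exact le_rfl

@[fun_prop]
theorem Action.measurable_precision (σ : Fin K → Fin J → ℝ) (k : Fin K) :
    Measurable (Action.precision σ k) :=
  measurable_from_top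

/-- The total precision about the score of query `k` gained in a history. -/
noncomputable def totalPrecision (σ : Fin K → Fin J → ℝ) {t : ℕ} (h : History K J t) (k : Fin K) :
    ℝ :=
  ∑ i, (h i).1.precision σ k

/-- The sum of the scores of query `k` in a history, weighted by their precisions. -/
noncomputable def weightedScore (σ : Fin K → Fin J → ℝ) {t : ℕ} (h : History K J t) (k : Fin K) :
    ℝ :=
  ∑ i, (h i).1.precision σ k * (h i).2

theorem totalPrecision_nonneg (σ : Fin K → Fin J → ℝ) {t : ℕ} (h : History K J t) (k : Fin K) :
    0 ≤ totalPrecision σ h k :=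
  Finset.sum_nonneg fun _ _ => Action.precision_nonneg _ _ _

@[fun_prop]
theorem measurable_totalPrecision (σ : Fin K → Fin J → ℝ) {t : ℕ} (k : Fin K) :
    Measurable fun h : History K J t => totalPrecision σ h k := by
  unfold totalPrecision
  exact Finset.measurable_sum _ fun i _ =>
    (Action.measurable_precision σ k).comp (measurable_fst.comp (measurable_pi_apply i))

@[fun_prop]
theorem measurable_weightedScore (σ : Fin K → Fin J → ℝ) {t : ℕ} (k : Fin K) :
    Measurable fun h : History K J t => weightedScore σ h k := by
  unfold weightedScore
  exact Finset.measurable_sum _ fun i _ =>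
    ((Action.measurable_precision σ k).comp (measurable_fst.comp (measurable_pi_apply i))).mul
      (measurable_snd.comp (measurable_pi_apply i))

/-- Links the posterior precisions to the query counts that the budget constrains. -/
theorem totalPrecision_eq_sum_numQueries (σ : Fin K → Fin J → ℝ) {t : ℕ} (h : History K J t)
    (k : Fin K) : totalPrecision σ h k = ∑ j, (numQueries h k j : ℝ) / σ k j ^ 2 := by
  have : ∀ a : Action K J, a.precision σ k =
      ∑ j, if a = .query k j then 1 / σ k j ^ 2 else 0 := by
    intro a
    cases a with
    | query k' j =>
      by_cases hk : k' = k
      · subst hk; simp [Action.precision]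
      · simp [Action.precision, hk]
    | idle => simp [Action.precision]
  simp only [totalPrecision, this, numQueries]
  rw [Finset.sum_comm]
  refine Finset.sum_congr rfl fun j _ => ?_
  rw [← Finset.sum_filter, Finset.sum_const, nsmul_eq_mul, mul_one_div]

/-- The likelihood of the scores `s` given a history, relative to the scores `0`. -/
noncomputable def likelihood (σ : Fin K → Fin J → ℝ) {t : ℕ} (s : Fin K → ℝ) (h : History K J t) :
    ℝ≥0∞ :=
  ∏ k, ENNReal.ofReal (Real.exp (s k * weightedScore σ h k - s k ^ 2 / 2 * totalPrecision σ h k))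

theorem measurable_likelihood (σ : Fin K → Fin J → ℝ) {t : ℕ} :
    Measurable fun x : (Fin K → ℝ) × History K J t => likelihood σ x.1 x.2 := by
  unfold likelihood
  fun_prop

theorem likelihood_snoc (σ : Fin K → Fin J → ℝ) {t : ℕ} (s : Fin K → ℝ) (h : History K J t)
    (a : Action K J) (y : ℝ) :
    likelihood σ s (History.snoc (h, (a, y))) = likelihood σ s h *
      ∏ k, ENNReal.ofReal (Real.exp (a.precision σ k * (s k * y - s k ^ 2 / 2))) := by
  rw [likelihood, likelihood, ← Finset.prod_mul_distrib]
  refine Finset.prod_congr rfl fun k _ => ?_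
  rw [← ENNReal.ofReal_mul (Real.exp_pos _).le, ← Real.exp_add]
  congr 2
  simp only [weightedScore, totalPrecision, History.snoc, Fin.sum_univ_castSucc, Fin.snoc_castSucc,
    Fin.snoc_last]
  ring

/-- One-round change of measure. A query to `k` carries no precision about other scores, so only the
factor of `k` differs from `1`; an idle round leaves all factors equal to `1`. -/
theorem lintegral_scoreKernel {σ : Fin K → Fin J → ℝ} (hσ : ∀ k j, 0 < σ k j) (s : Fin K → ℝ)
    (a : Action K J) {f : ℝ → ℝ≥0∞} (hf : Measurable f) :
    ∫⁻ y, f y ∂(scoreKernel s σ a) =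
      ∫⁻ y, (∏ k, ENNReal.ofReal (Real.exp (a.precision σ k * (s k * y - s k ^ 2 / 2)))) * f y
        ∂(scoreKernel 0 σ a) := by
  cases a with
  | query k j =>
    have hprod : ∀ y, (∏ k', ENNReal.ofReal
        (Real.exp ((Action.query k j).precision σ k' * (s k' * y - s k' ^ 2 / 2)))) =
        ENNReal.ofReal (Real.exp (1 / σ k j ^ 2 * (s k * y - s k ^ 2 / 2))) := by
      intro y
      rw [Finset.prod_eq_single k]
      · simp [Action.precision]
      · intro k' _ hk'
        simp [Action.precision, hk'.symm]
      · simp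
    simp_rw [hprod]
    change ∫⁻ y, f y ∂(gaussianReal (s k) _) = ∫⁻ y, _ ∂(gaussianReal 0 _)
    rw [gaussianReal_eq_withDensity (hσ k j),
      lintegral_withDensity_eq_lintegral_mul _ (by fun_prop) hf]
    rfl
  | idle => simp [Action.precision, scoreKernel, scoreMeasure]

namespace Algorithm

theorem lintegral_historyLaw_succ (A : Algorithm K J) (s : Fin K → ℝ) (σ : Fin K → Fin J → ℝ)
    (t : ℕ) {f : History K J (t + 1) → ℝ≥0∞} (hf : Measurable f) :
    ∫⁻ h, f h ∂(A.historyLaw s σ (t + 1)) =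
      ∫⁻ h, ∫⁻ a, ∫⁻ y, f (History.snoc (h, (a, y))) ∂(scoreKernel s σ a) ∂(A.policy t h)
        ∂(A.historyLaw s σ t) := by
  rw [historyLaw, lintegral_map hf History.measurable_snoc,
    Measure.lintegral_compProd (f := fun x => f (History.snoc x)) (hf.comp History.measurable_snoc)]
  refine lintegral_congr fun h => ?_
  rw [stepKernel, Kernel.lintegral_compProd (f := fun x => f (History.snoc (h, x))) _ _ _
    (hf.comp (History.measurable_snoc.comp measurable_prodMk_left))]
  simp [Kernel.prodMkLeft_apply]

/-- By induction on the rounds: actions are drawn from the same policy under `s` and under `0`, so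
only the observed scores contribute to the density. -/
theorem lintegral_historyLaw (A : Algorithm K J) {σ : Fin K → Fin J → ℝ}
    (hσ : ∀ k j, 0 < σ k j) (s : Fin K → ℝ) (t : ℕ) {f : History K J t → ℝ≥0∞}
    (hf : Measurable f) :
    ∫⁻ h, f h ∂(A.historyLaw s σ t) = ∫⁻ h, likelihood σ s h * f h ∂(A.historyLaw 0 σ t) := by
  have hlik : ∀ t, Measurable fun h : History K J t => likelihood σ s h := fun t => by
    unfold likelihood; fun_prop
  induction t with
  | zero => simp [historyLaw, likelihood, weightedScore, totalPrecision]
  | succ t ih =>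
    have hstep : Measurable fun h : History K J t =>
        ∫⁻ a, ∫⁻ y, f (History.snoc (h, (a, y))) ∂(scoreKernel s σ a) ∂(A.policy t h) := by
      have h1 : Measurable fun x : History K J t × Action K J =>
          ∫⁻ y, f (History.snoc (x.1, (x.2, y)))
            ∂(Kernel.prodMkLeft (History K J t) (scoreKernel s σ) x) :=
        Measurable.lintegral_kernel_prod_right'
          (f := fun z : (History K J t × Action K J) × ℝ => f (History.snoc (z.1.1, (z.1.2, z.2))))
          (hf.comp (History.measurable_snoc.comp (by fun_prop)))
      exact Measurable.lintegral_kernel_prod_right' (κ := A.policy t) h1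
    rw [A.lintegral_historyLaw_succ s σ t hf, A.lintegral_historyLaw_succ 0 σ t
      (f := fun h => likelihood σ s h * f h) ((hlik _).mul hf), ih hstep]
    refine lintegral_congr fun h => ?_
    rw [← lintegral_const_mul _ measurable_from_top]
    refine lintegral_congr fun a => ?_
    have hfy : Measurable fun y => f (History.snoc (h, (a, y))) :=
      hf.comp (History.measurable_snoc.comp (by fun_prop))
    rw [lintegral_scoreKernel hσ s a hfy, ← lintegral_const_mul' (likelihood σ s h) _
      (ENNReal.prod_ne_top fun _ _ => ENNReal.ofReal_ne_top)]
    refine lintegral_congr fun y => ?_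
    rw [likelihood_snoc, mul_assoc]

end Algorithm

/-! ### Posterior and Bayes risk. -/

/-- The prior under which the scores are independent centred Gaussians of precision `ε`. -/
noncomputable def prior (K : ℕ) (ε : ℝ) : Measure (Fin K → ℝ) :=
  Measure.pi fun _ => gaussianReal 0 (Real.toNNReal ε⁻¹)

/-- The distribution of the scores given a history, under the prior of precision `ε`. -/
noncomputable def posterior (σ : Fin K → Fin J → ℝ) (ε : ℝ) {t : ℕ} (h : History K J t) :
    Measure (Fin K → ℝ) :=
  Measure.pi fun k => gaussianReal (weightedScore σ h k / (ε + totalPrecision σ h k))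
    (Real.toNNReal (ε + totalPrecision σ h k)⁻¹)

instance (K : ℕ) (ε : ℝ) : IsProbabilityMeasure (prior K ε) := by
  unfold prior; infer_instance

instance (σ : Fin K → Fin J → ℝ) (ε : ℝ) {t : ℕ} (h : History K J t) :
    IsProbabilityMeasure (posterior σ ε h) := by
  unfold posterior; infer_instance

/-- Bayes' rule. -/
theorem lintegral_likelihood_mul_prior (σ : Fin K → Fin J → ℝ) {ε : ℝ} (hε : 0 < ε) {t : ℕ}
    (h : History K J t) {G : (Fin K → ℝ) → ℝ≥0∞} (hG : Measurable G) :
    ∫⁻ s, likelihood σ s h * G s ∂(prior K ε) =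
      (∫⁻ s, likelihood σ s h ∂(prior K ε)) * ∫⁻ s, G s ∂(posterior σ ε h) := by
  have key : ∀ G : (Fin K → ℝ) → ℝ≥0∞, Measurable G →
      ∫⁻ s, likelihood σ s h * G s ∂(prior K ε) = _ := fun G hG =>
    lintegral_pi_prod_mul
      (f := fun k x => ENNReal.ofReal
        (Real.exp (x * weightedScore σ h k - x ^ 2 / 2 * totalPrecision σ h k)))
      (fun k => by fun_prop) (fun k => ENNReal.ofReal_ne_top)
      (fun k => gaussianReal_withDensity_exp hε (totalPrecision_nonneg σ h k) _) hG
  -- Taking `G = 1` identifies the product of the constants as the marginal likelihood.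
  have h1 := key 1 measurable_one
  simp only [Pi.one_apply, mul_one, lintegral_one, measure_univ] at h1
  rw [key G hG, h1]
  rfl

namespace Algorithm

/-- If the posterior expected loss of every estimate is at least `b`, then `b` bounds from below
any uniform bound on the expected loss. -/
theorem le_of_forall_risk_le (A : Algorithm K J) {σ : Fin K → Fin J → ℝ}
    (hσ : ∀ k j, 0 < σ k j) {ε : ℝ} (hε : 0 < ε) {F : (Fin K → ℝ) → ℝ≥0∞} (hF : Measurable F)
    {b R : ℝ≥0∞} (hR : ∀ s, ∫⁻ x, F (x - s) ∂(A.estimateLaw s σ) ≤ R)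
    (hb : ∀ᵐ h ∂(A.historyLaw 0 σ A.horizon), ∀ x,
      b ≤ ∫⁻ s, F (x - s) ∂(posterior σ ε h)) : b ≤ R := by
  set μ := A.historyLaw 0 σ A.horizon
  have hFs : Measurable fun z : (Fin K → ℝ) × (Fin K → ℝ) => F (z.2 - z.1) := hF.comp (by fun_prop)
  have hG : Measurable fun z : (Fin K → ℝ) × History K J A.horizon =>
      ∫⁻ x, F (x - z.1) ∂(A.estimator z.2) :=
    Measurable.lintegral_kernel_prod_right' (κ := A.estimator.comap Prod.snd measurable_snd)
      (f := fun w : ((Fin K → ℝ) × History K J A.horizon) × (Fin K → ℝ) => F (w.2 - w.1.1))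
      (hF.comp (by fun_prop))
  have hrisk : ∀ s, ∫⁻ x, F (x - s) ∂(A.estimateLaw s σ) =
      ∫⁻ h, likelihood σ s h * ∫⁻ x, F (x - s) ∂(A.estimator h) ∂μ := by
    intro s
    have hFx : Measurable fun x => F (x - s) := hF.comp (measurable_id.sub_const s)
    rw [estimateLaw, Measure.lintegral_bind A.estimator.measurable.aemeasurable hFx.aemeasurable]
    exact A.lintegral_historyLaw hσ s _ (hG.comp measurable_prodMk_left)
  have hlik := measurable_likelihood (J := J) σ (t := A.horizon)
  -- The marginal likelihood is a probability density for the history, since each `likelihood σ s`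
  -- is one; so the constant `b` can be averaged against it.
  have hmass : ∫⁻ h, ∫⁻ s, likelihood σ s h ∂(prior K ε) ∂μ = 1 := by
    rw [lintegral_lintegral_swap (f := fun h s => likelihood σ s h)
      (hlik.comp measurable_swap).aemeasurable]
    have : ∀ s, ∫⁻ h, likelihood σ s h ∂μ = 1 := by
      intro s
      have := A.lintegral_historyLaw hσ s A.horizon measurable_one
      simpa using this.symm
    simp [this]
  calc b = ∫⁻ h, (∫⁻ s, likelihood σ s h ∂(prior K ε)) * b ∂μ := by
        rw [lintegral_mul_const _ hlik.lintegral_prod_left', hmass, one_mul]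
    _ ≤ ∫⁻ h, (∫⁻ s, likelihood σ s h ∂(prior K ε)) *
          ∫⁻ s, ∫⁻ x, F (x - s) ∂(A.estimator h) ∂(posterior σ ε h) ∂μ := by
        refine lintegral_mono_ae ?_
        filter_upwards [hb] with h hh
        gcongr
        -- With the estimate integrated outermost, the bound for each fixed estimate also covers
        -- randomized ones.
        rw [lintegral_lintegral_swap hFs.aemeasurable]
        calc b = ∫⁻ _, b ∂(A.estimator h) := by simp
          _ ≤ _ := lintegral_mono hh
    _ = ∫⁻ h, ∫⁻ s, likelihood σ s h * ∫⁻ x, F (x - s) ∂(A.estimator h) ∂(prior K ε) ∂μ :=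
        lintegral_congr fun h =>
          (lintegral_likelihood_mul_prior σ hε h (hG.comp measurable_prodMk_right)).symm
    _ = ∫⁻ s, ∫⁻ x, F (x - s) ∂(A.estimateLaw s σ) ∂(prior K ε) := by
        rw [lintegral_lintegral_swap
          (f := fun h s => likelihood σ s h * ∫⁻ x, F (x - s) ∂(A.estimator h))
          ((hlik.mul hG).comp measurable_swap).aemeasurable]
        exact lintegral_congr fun s => (hrisk s).symm
    _ ≤ ∫⁻ _, R ∂(prior K ε) := lintegral_mono hR
    _ = R := by simp

end Algorithm
-- The `ℓ_p` norms and Jensen's inequality.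
theorem ellNorm_top (x : Fin K → ℝ) : ellNorm ∞ x = ⨆ k, ENNReal.ofReal |x k| := by
  rw [ellNorm, ofReal_norm, enorm_eq_nnnorm, PiLp.nnnorm_eq_ciSup,
    ENNReal.coe_iSup (Set.finite_range _).bddAbove]
  refine iSup_congr fun k => ?_
  rw [← Real.norm_eq_abs, ofReal_norm, enorm_eq_nnnorm]

theorem ellNorm_eq_sum {p : ℝ≥0∞} (hp : 1 ≤ p) (hp' : p ≠ ∞) (x : Fin K → ℝ) :
    ellNorm p x = (∑ k, ENNReal.ofReal |x k| ^ p.toReal) ^ (1 / p.toReal) := by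
  have h0 : 0 < p.toReal := ENNReal.toReal_pos (one_pos.trans_le hp).ne' hp'
  rw [ellNorm, PiLp.norm_eq_sum h0,
    ← ENNReal.ofReal_rpow_of_nonneg (by positivity) (by positivity),
    ENNReal.ofReal_sum_of_nonneg fun _ _ => by positivity]
  congr 1
  refine Finset.sum_congr rfl fun k _ => ?_
  rw [← ENNReal.ofReal_rpow_of_nonneg (norm_nonneg _) h0.le]
  rfl

theorem ellNorm_rpow_eq_sum {p : ℝ≥0∞} (hp : 1 ≤ p) (hp' : p ≠ ∞) (x : Fin K → ℝ) :
    ellNorm p x ^ p.toReal = ∑ k, ENNReal.ofReal |x k| ^ p.toReal := by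
  have h0 : p.toReal ≠ 0 := (ENNReal.toReal_pos (one_pos.trans_le hp).ne' hp').ne'
  rw [ellNorm_eq_sum hp hp', ← ENNReal.rpow_mul, one_div_mul_cancel h0, ENNReal.rpow_one]

theorem ellNorm_mono {p : ℝ≥0∞} (hp : 1 ≤ p) {x y : Fin K → ℝ} (h : ∀ k, |x k| ≤ |y k|) :
    ellNorm p x ≤ ellNorm p y := by
  by_cases hp' : p = ∞
  · subst hp'
    rw [ellNorm_top, ellNorm_top]
    exact iSup_mono fun k => ENNReal.ofReal_le_ofReal (h k)
  · rw [ellNorm_eq_sum hp hp', ellNorm_eq_sum hp hp']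
    exact ENNReal.rpow_le_rpow (Finset.sum_le_sum fun k _ =>
      ENNReal.rpow_le_rpow (ENNReal.ofReal_le_ofReal (h k)) ENNReal.toReal_nonneg)
      (one_div_nonneg.2 ENNReal.toReal_nonneg)

theorem ellNorm_const_mul {p : ℝ≥0∞} (hp : 1 ≤ p) (a : ℝ) (x : Fin K → ℝ) :
    ellNorm p (fun k => a * x k) = ENNReal.ofReal |a| * ellNorm p x := by
  have : Fact (1 ≤ p) := ⟨hp⟩
  have : WithLp.toLp p (fun k => a * x k) = a • WithLp.toLp p x := rfl
  rw [ellNorm, ellNorm, this, norm_smul, ENNReal.ofReal_mul (norm_nonneg a), Real.norm_eq_abs]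

theorem measurable_ellNorm {p : ℝ≥0∞} (hp : 1 ≤ p) :
    Measurable (ellNorm p : (Fin K → ℝ) → ℝ≥0∞) := by
  have : Fact (1 ≤ p) := ⟨hp⟩
  unfold ellNorm
  exact ENNReal.measurable_ofReal.comp
    (continuous_norm.comp (PiLp.continuous_toLp p fun _ : Fin K => ℝ)).measurable

/-- Jensen's inequality for an `ℓ_p` norm. -/
theorem ellNorm_integral_abs_le {p : ℝ≥0∞} (hp : 1 ≤ p) {μ : Measure (Fin K → ℝ)}
    {g : Fin K → (Fin K → ℝ) → ℝ} (hg : ∀ k, Integrable (g k) μ) :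
    ellNorm p (fun k => ∫ s, |g k s| ∂μ) ≤ ∫⁻ s, ellNorm p (fun k => g k s) ∂μ := by
  have : Fact (1 ≤ p) := ⟨hp⟩
  have hint : ∀ k, Integrable
      (fun s => (WithLp.toLp p fun k => |g k s| : PiLp p fun _ : Fin K => ℝ) k) μ := fun k => (hg k).abs
  -- As a Bochner integral in `PiLp p`, the vector of means is subject to the inequality between the
  -- norm of an integral and the integral of the norm, which covers `p = ∞` as well.
  have hcoord : WithLp.toLp p (fun k => ∫ s, |g k s| ∂μ) =
      ∫ s, (WithLp.toLp p fun k => |g k s| : PiLp p fun _ : Fin K => ℝ) ∂μ := by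
    ext k
    rw [eval_integral_piLp hint]
  rw [ellNorm, hcoord, ofReal_norm]
  refine (enorm_integral_le_lintegral_enorm _).trans (lintegral_mono fun s => ?_)
  rw [← ofReal_norm]
  exact ellNorm_mono hp fun k => (abs_abs _).le

theorem integral_abs_gaussianReal :
    ∫ z, |z| ∂(gaussianReal 0 1) = Real.sqrt (2 / Real.pi) := by
  have h := integral_abs_rpow_gaussianReal one_pos
  simp only [Real.rpow_one] at h
  rw [h, add_self_div_two, Real.Gamma_one, Real.sqrt_div zero_le_two, mul_one_div]

/-! ### Lower bounds on the posterior loss. -/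

/-- Standard deviations of the scores under the posterior. -/
noncomputable def posteriorDev (σ : Fin K → Fin J → ℝ) (ε : ℝ) {t : ℕ} (h : History K J t) :
    Fin K → ℝ :=
  fun k => Real.sqrt (ε + totalPrecision σ h k)⁻¹

/-- Jensen moves the expectation inside the norm, leaving first absolute moments of the marginals;
hence the constant `E|Z|` for every `p`. -/
theorem le_lintegral_ellNorm_posterior {p : ℝ≥0∞} (hp : 1 ≤ p) (σ : Fin K → Fin J → ℝ) {ε : ℝ}
    (hε : 0 < ε) {t : ℕ} (h : History K J t) (x : Fin K → ℝ) :
    ENNReal.ofReal (Real.sqrt (2 / Real.pi)) * ellNorm p (posteriorDev σ ε h) ≤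
      ∫⁻ s, ellNorm p (x - s) ∂(posterior σ ε h) := by
  have hmp : ∀ k, MeasurePreserving (Function.eval k) (posterior σ ε h) _ := fun k =>
    measurePreserving_eval _ k
  have hint1 : ∀ (k : Fin K) (m : ℝ) (v : ℝ≥0), Integrable (fun y => x k - y) (gaussianReal m v) :=
    fun k m v => (integrable_const _).sub
      ((memLp_id_gaussianReal' 1 ENNReal.one_ne_top).integrable le_rfl)
  have hint : ∀ k, Integrable (fun s : Fin K → ℝ => x k - s k) (posterior σ ε h) := fun k =>
    (hmp k).integrable_comp_of_integrable (hint1 k _ _)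
  refine le_trans ?_ (ellNorm_integral_abs_le hp hint)
  rw [← abs_of_nonneg (Real.sqrt_nonneg (2 / Real.pi)), ← ellNorm_const_mul hp]
  refine ellNorm_mono hp fun k => ?_
  rw [abs_of_nonneg (by unfold posteriorDev; positivity),
    abs_of_nonneg (integral_nonneg fun _ => abs_nonneg _)]
  have hv : 0 ≤ (ε + totalPrecision σ h k)⁻¹ :=
    inv_nonneg.2 (add_nonneg hε.le (totalPrecision_nonneg σ h k))
  have h1 := le_lintegral_abs_sub_rpow_gaussianReal
    (weightedScore σ h k / (ε + totalPrecision σ h k)) (x k) hv le_rfl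
  simp only [Real.rpow_one, integral_abs_gaussianReal] at h1
  rw [← ofReal_integral_eq_lintegral_ofReal (hint1 k _ _).abs
    (Filter.Eventually.of_forall fun _ => abs_nonneg _),
    ENNReal.ofReal_le_ofReal_iff (integral_nonneg fun _ => abs_nonneg _)] at h1
  refine h1.trans_eq ?_
  rw [← (hmp k).map_eq, integral_map (measurable_pi_apply k).aemeasurable
    (by fun_prop)]
  rfl

/-- The `p`-th power of the norm is a sum over coordinates, so each marginal contributes its own
`p`-th moment and Jensen for the norm is not needed. -/
theorem le_lintegral_ellNorm_rpow_posterior {p : ℝ≥0∞} (hp : 1 ≤ p) (hp' : p ≠ ∞)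
    (σ : Fin K → Fin J → ℝ) {ε : ℝ} (hε : 0 < ε) {t : ℕ} (h : History K J t) (x : Fin K → ℝ) :
    ENNReal.ofReal (∫ z, |z| ^ p.toReal ∂(gaussianReal 0 1)) *
        ellNorm p (posteriorDev σ ε h) ^ p.toReal ≤
      ∫⁻ s, ellNorm p (x - s) ^ p.toReal ∂(posterior σ ε h) := by
  have hq : 1 ≤ p.toReal := by simpa using ENNReal.toReal_mono hp' hp
  have hq0 : 0 ≤ p.toReal := by linarith
  simp_rw [ellNorm_rpow_eq_sum hp hp']
  rw [lintegral_finsetSum _ fun k _ => by fun_prop, Finset.mul_sum]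
  refine Finset.sum_le_sum fun k _ => ?_
  have hv : 0 ≤ (ε + totalPrecision σ h k)⁻¹ :=
    inv_nonneg.2 (add_nonneg hε.le (totalPrecision_nonneg σ h k))
  have h1 := le_lintegral_abs_sub_rpow_gaussianReal
    (weightedScore σ h k / (ε + totalPrecision σ h k)) (x k) hv hq
  rw [ENNReal.ofReal_mul (integral_nonneg fun _ => by positivity)] at h1
  rw [ENNReal.ofReal_rpow_of_nonneg (abs_nonneg _) hq0, posteriorDev,
    abs_of_nonneg (Real.sqrt_nonneg _)]
  refine h1.trans_eq ?_
  have hmp : MeasurePreserving (Function.eval k) (posterior σ ε h) _ := measurePreserving_eval _ k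
  rw [← hmp.lintegral_comp (by fun_prop)]
  refine lintegral_congr fun s => ?_
  rw [ENNReal.ofReal_rpow_of_nonneg (abs_nonneg _) hq0]
  rfl

/-! ### Reduction to the allocation problem. -/

/-- The standard deviations achieved by an allocation `n` of (fractional) queries are bounded
below through the optimal value of the allocation problem. -/
theorem optAlloc_div_rpow_le_ellNorm {p : ℝ≥0∞} (hp : 1 ≤ p) {σ : Fin K → Fin J → ℝ}
    {c : Fin J → ℝ} (hc : ∀ j, 0 < c j) {n : Fin K → Fin J → ℝ} (hn : ∀ k j, 0 ≤ n k j)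
    (hT : 0 < ∑ k, ∑ j, c j * n k j) (hq : ∀ k, 0 < ∑ j, n k j / σ k j ^ 2) {B : ℝ}
    (hB : ∑ k, ∑ j, c j * n k j ≤ B) :
    (optAlloc p σ c / ENNReal.ofReal B) ^ (1 / 2 : ℝ) ≤
      ellNorm p fun k => Real.sqrt (∑ j, n k j / σ k j ^ 2)⁻¹ := by
  set T := ∑ k, ∑ j, c j * n k j
  set q : Fin K → ℝ := fun k => ∑ j, n k j / σ k j ^ 2
  set E := ellNorm p fun k => Real.sqrt (q k)⁻¹
  -- The fraction of the total cost `T` spent on each pair; the costs then cancel in the objective,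
  -- leaving the precisions divided by `T`.
  set ω : Fin K → Fin J → ℝ := fun k j => c j * n k j / T
  have hω : ω ∈ allocations K J := by
    refine ⟨fun k j => div_nonneg (mul_nonneg (hc j).le (hn k j)) hT.le, ?_⟩
    simp only [ω, ← Finset.sum_div]
    exact div_self hT.ne'
  have hsum : ∀ k, ∑ j, ω k j / (c j * σ k j ^ 2) = q k / T := by
    intro k
    simp only [ω, q, Finset.sum_div]
    refine Finset.sum_congr rfl fun j _ => ?_
    rw [div_div, mul_left_comm, mul_div_mul_left _ _ (hc j).ne', mul_comm T, div_div]
  have hinv : ∀ k, (ENNReal.ofReal (q k / T))⁻¹ =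
      ENNReal.ofReal T * ENNReal.ofReal |Real.sqrt (q k)⁻¹| ^ (2 : ℝ) := by
    intro k
    have := hq k
    rw [← ENNReal.ofReal_inv_of_pos (div_pos this hT), abs_of_nonneg (Real.sqrt_nonneg _),
      ENNReal.ofReal_rpow_of_nonneg (Real.sqrt_nonneg _) zero_le_two, ← ENNReal.ofReal_mul hT.le,
      Real.rpow_two, Real.sq_sqrt (inv_nonneg.2 this.le), inv_div, div_eq_mul_inv]
  have hobj : allocObjective p ω σ c ≤ ENNReal.ofReal T * E ^ (2 : ℝ) := by
    rw [allocObjective]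
    simp only [hsum]
    split_ifs with hp'
    · refine iSup_le fun k => ?_
      rw [hinv]
      gcongr
      simp only [E, hp', ellNorm_top]
      exact le_iSup (fun k => ENNReal.ofReal |Real.sqrt (q k)⁻¹|) k
    · have h0 : 0 < p.toReal := ENNReal.toReal_pos (one_pos.trans_le hp).ne' hp'
      have hterm : ∀ k, ENNReal.ofReal (q k / T) ^ (-(p.toReal / 2)) =
          ENNReal.ofReal T ^ (p.toReal / 2) * ENNReal.ofReal |Real.sqrt (q k)⁻¹| ^ p.toReal := by
        intro k
        rw [ENNReal.rpow_neg, ← ENNReal.inv_rpow, hinv,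
          ENNReal.mul_rpow_of_nonneg _ _ (by positivity), ← ENNReal.rpow_mul,
          mul_div_cancel₀ _ two_ne_zero]
      simp only [hterm, E, ellNorm_eq_sum hp hp']
      rw [← Finset.mul_sum, ENNReal.mul_rpow_of_nonneg _ _ (by positivity), ← ENNReal.rpow_mul,
        ← ENNReal.rpow_mul, div_mul_div_cancel₀ two_ne_zero, div_self h0.ne', ENNReal.rpow_one,
        one_div_mul_eq_div]
  have hopt : optAlloc p σ c ≤ ENNReal.ofReal B * E ^ (2 : ℝ) :=
    (iInf₂_le ω hω).trans (hobj.trans (by gcongr))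
  calc (optAlloc p σ c / ENNReal.ofReal B) ^ (1 / 2 : ℝ)
      ≤ (E ^ (2 : ℝ)) ^ (1 / 2 : ℝ) := by
        gcongr
        exact ENNReal.div_le_of_le_mul' hopt
    _ = E := by rw [← ENNReal.rpow_mul]; norm_num

theorem optAlloc_div_rpow_le_ellNorm_posteriorDev {p : ℝ≥0∞} (hp : 1 ≤ p) (hK : 0 < K)
    {σ : Fin K → Fin J → ℝ} (hσ : ∀ k j, 0 < σ k j) {c : Fin J → ℝ} (hc : ∀ j, 0 < c j)
    (j₀ : Fin J) {B : ℝ} {ε : ℝ} (hε : 0 < ε) {t : ℕ} (h : History K J t)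
    (hB : ∑ j, c j * ∑ k, (numQueries h k j : ℝ) ≤ B) :
    (optAlloc p σ c / ENNReal.ofReal (B + ε * ∑ k, c j₀ * σ k j₀ ^ 2)) ^ (1 / 2 : ℝ) ≤
      ellNorm p (posteriorDev σ ε h) := by
  -- Prior precision `ε` on score `k` is worth `ε * σ k j₀ ^ 2` fractional queries to judge `j₀`.
  -- These also keep the total cost and every precision positive when nothing is queried.
  set n : Fin K → Fin J → ℝ := fun k j => numQueries h k j + if j = j₀ then ε * σ k j₀ ^ 2 else 0
  have hn : ∀ k j, 0 ≤ n k j := fun k j => by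
    simp only [n]; split_ifs <;> positivity
  have hq : ∀ k, ∑ j, n k j / σ k j ^ 2 = ε + totalPrecision σ h k := by
    intro k
    have := (hσ k j₀).ne'
    have h2 : ∀ j, (if j = j₀ then ε * σ k j₀ ^ 2 else 0) / σ k j ^ 2 = if j = j₀ then ε else 0 := by
      intro j
      split_ifs with hj
      · subst hj; field_simp
      · simp
    simp only [n, add_div, Finset.sum_add_distrib, h2, totalPrecision_eq_sum_numQueries]
    simp [add_comm]
  have hcost : ∑ k, ∑ j, c j * n k j =
      ∑ j, c j * ∑ k, (numQueries h k j : ℝ) + ε * ∑ k, c j₀ * σ k j₀ ^ 2 := by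
    simp only [n, mul_add, Finset.sum_add_distrib, mul_ite, mul_zero, Finset.sum_ite_eq',
      Finset.mem_univ, if_true, Finset.mul_sum]
    rw [Finset.sum_comm]
    congr 1
    exact Finset.sum_congr rfl fun k _ => by ring
  have hpos : 0 < ∑ k, ∑ j, c j * n k j := by
    have : Nonempty (Fin K) := ⟨⟨0, hK⟩⟩
    rw [hcost]
    have h1 : 0 ≤ ∑ j, c j * ∑ k, (numQueries h k j : ℝ) :=
      Finset.sum_nonneg fun j _ => mul_nonneg (hc j).le (by positivity)
    have h2 : 0 < ∑ k, c j₀ * σ k j₀ ^ 2 :=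
      Finset.sum_pos (fun k _ => mul_pos (hc j₀) (pow_pos (hσ k j₀) 2)) Finset.univ_nonempty
    positivity
  have := optAlloc_div_rpow_le_ellNorm hp (σ := σ) hc hn hpos
    (fun k => by rw [hq]; exact add_pos_of_pos_of_nonneg hε (totalPrecision_nonneg σ h k))
    (hcost.trans_le (add_le_add_left hB _))
  simp only [hq] at this
  exact this

/-- Lets the prior precision tend to `0`, removing the cost `ε * D` of the fractional queries. -/
theorem mul_rpow_div_le_of_forall_pos {C a R : ℝ≥0∞} (hC : C ≠ ∞) {B D : ℝ}
    (h : ∀ ε : ℝ, 0 < ε → C * (a / ENNReal.ofReal (B + ε * D)) ^ (1 / 2 : ℝ) ≤ R) :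
    C * (a / ENNReal.ofReal B) ^ (1 / 2 : ℝ) ≤ R := by
  have h1 : Filter.Tendsto (fun ε : ℝ => ENNReal.ofReal (B + ε * D)) (nhdsWithin 0 (Set.Ioi 0))
      (nhds (ENNReal.ofReal B)) := by
    refine ENNReal.tendsto_ofReal (Filter.Tendsto.mono_left ?_ nhdsWithin_le_nhds)
    have : Continuous fun ε : ℝ => B + ε * D := by fun_prop
    simpa using this.tendsto 0
  have h2 := ENNReal.Tendsto.const_div (a := a) h1 (Or.inl ENNReal.ofReal_ne_top)
  have h3 := ENNReal.Tendsto.const_mul (a := C)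
    ((ENNReal.continuous_rpow_const (y := (1 / 2 : ℝ))).continuousAt.tendsto.comp h2) (Or.inr hC)
  refine le_of_tendsto h3 ?_
  filter_upwards [self_mem_nhdsWithin] with ε hε using h ε hε

end JudgeEstimation

/-! ### The minimax lower bounds. -/

theorem theoremF6 (K J : ℕ) (hK : 0 < K) (hJ : 0 < J)
    (σ : Fin K → Fin J → ℝ) (hσ : ∀ k j, 0 < σ k j)
    (c : Fin J → ℝ) (hc : ∀ j, 0 < c j) (B : ℝ) (hB : 0 < B) :
    (∀ p : ℝ≥0∞, 1 ≤ p →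
      ENNReal.ofReal (Real.sqrt (2 / Real.pi)) *
          (JudgeEstimation.optAlloc p σ c / ENNReal.ofReal B) ^ (1 / 2 : ℝ) ≤
        ⨅ (A : JudgeEstimation.Algorithm K J) (_ : A.WithinBudget σ c B),
          ⨆ s : Fin K → ℝ, A.risk σ p s) ∧
    (∀ p : ℝ≥0∞, 1 ≤ p → p ≠ ∞ →
      JudgeEstimation.gaussianMoment p.toReal =
          Real.sqrt 2 * (Real.Gamma ((p.toReal + 1) / 2) / Real.sqrt Real.pi) ^ (1 / p.toReal) ∧
      ENNReal.ofReal (JudgeEstimation.gaussianMoment p.toReal) *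
          (JudgeEstimation.optAlloc p σ c / ENNReal.ofReal B) ^ (1 / 2 : ℝ) ≤
        ⨅ (A : JudgeEstimation.Algorithm K J) (_ : A.WithinBudget σ c B),
          ⨆ s : Fin K → ℝ, A.momentRisk σ p s) := by
  refine ⟨fun p hp => ?_, fun p hp hp' => ?_⟩
  · refine le_iInf₂ fun A hA => JudgeEstimation.mul_rpow_div_le_of_forall_pos
      ENNReal.ofReal_ne_top (D := ∑ k, c ⟨0, hJ⟩ * σ k ⟨0, hJ⟩ ^ 2) fun ε hε => ?_
    refine A.le_of_forall_risk_le hσ hε (JudgeEstimation.measurable_ellNorm hp)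
      (fun s => le_iSup (fun s => A.risk σ p s) s) ?_
    -- The budget is needed only under the reference scores `0`, since the other history laws enter
    -- through their densities.
    filter_upwards [hA 0] with h hh x
    refine le_trans ?_ (JudgeEstimation.le_lintegral_ellNorm_posterior hp σ hε h x)
    gcongr
    exact JudgeEstimation.optAlloc_div_rpow_le_ellNorm_posteriorDev hp hK hσ hc _ hε h hh
  · have hq : 0 < p.toReal := ENNReal.toReal_pos (one_pos.trans_le hp).ne' hp'
    constructor
    · rw [JudgeEstimation.gaussianMoment, integral_abs_rpow_gaussianReal hq,
        Real.mul_rpow (by positivity)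
          (div_nonneg (Real.Gamma_pos_of_pos (by positivity)).le (Real.sqrt_nonneg _)),
        ← Real.rpow_mul (Real.sqrt_nonneg _), mul_one_div_cancel hq.ne', Real.rpow_one]
    · refine le_iInf₂ fun A hA => JudgeEstimation.mul_rpow_div_le_of_forall_pos
        ENNReal.ofReal_ne_top (D := ∑ k, c ⟨0, hJ⟩ * σ k ⟨0, hJ⟩ ^ 2) fun ε hε => ?_
      set R := ⨆ s : Fin K → ℝ, A.momentRisk σ p s
      set E := (JudgeEstimation.optAlloc p σ c /
        ENNReal.ofReal (B + ε * ∑ k, c ⟨0, hJ⟩ * σ k ⟨0, hJ⟩ ^ 2)) ^ (1 / 2 : ℝ)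
      have hrisk : ∀ s, ∫⁻ x, JudgeEstimation.ellNorm p (x - s) ^ p.toReal
          ∂(A.estimateLaw s σ) ≤ R ^ p.toReal := by
        intro s
        have := ENNReal.rpow_le_rpow (le_iSup (fun s => A.momentRisk σ p s) s) hq.le
        rwa [JudgeEstimation.Algorithm.momentRisk, ← ENNReal.rpow_mul,
          one_div_mul_cancel hq.ne', ENNReal.rpow_one] at this
      -- The Bayes argument applies to expected losses, so it is run on `p`-th powers and the root
      -- is taken afterwards.
      have key : ENNReal.ofReal (∫ z, |z| ^ p.toReal ∂(gaussianReal 0 1)) * E ^ p.toReal ≤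
          R ^ p.toReal := by
        refine A.le_of_forall_risk_le hσ hε
          ((JudgeEstimation.measurable_ellNorm hp).pow_const _) hrisk ?_
        filter_upwards [hA 0] with h hh x
        refine le_trans ?_
          (JudgeEstimation.le_lintegral_ellNorm_rpow_posterior hp hp' σ hε h x)
        gcongr
        exact JudgeEstimation.optAlloc_div_rpow_le_ellNorm_posteriorDev hp hK hσ hc _ hε h hh
      clear_value E R
      have := ENNReal.rpow_le_rpow key (one_div_nonneg.2 hq.le)
      rwa [ENNReal.mul_rpow_of_nonneg _ _ (one_div_nonneg.2 hq.le), ← ENNReal.rpow_mul,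
        ← ENNReal.rpow_mul, mul_one_div_cancel hq.ne', ENNReal.rpow_one, ENNReal.rpow_one,
        ENNReal.ofReal_rpow_of_nonneg (integral_nonneg fun _ => by positivity)
          (one_div_nonneg.2 hq.le)] at this
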